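/- Let $\alpha\in(0,1)$ and let $f_\alpha$ be the density, continuous on $(0,+\infty)$, of the positive $\alpha$-stable law, i.e. of the probability law on $(0,+\infty)$ with Laplace transform $\int_0^{+\infty}e^{-\lambda x}f_\alpha(x)\,dx=e^{-\lambda^\alpha}$ for every $\lambda\ge 0$. For every integer $n\ge 1$ and every $z>0$, the integral $$\mathcal I_n(z):=\int_0^{+\infty}e^{-n(zy-\log y)}f_\alpha(y)\,dy$$ converges. There is a continuous function $\Delta:(0,+\infty)\to(0,+\infty)$, independent of $n$, such that (i) for every integer $n\ge1$ there exists a continuous function $\delta_n:(0,+\infty)\to\mathbb R$ with $$\mathcal I_n(z)=\Big(\frac1z\Big)^{n+1}f_\alpha\Big(\frac1z\Big)e^{-n}\sqrt{\frac{2\pi}{n}}\,\big[1+\delta_n(z)\big]\qquad\text{and}\qquad|\delta_n(z)|\le\frac{\Delta(z)}{n}\qquad\text{for all }z>0;$$ (ii) $\Delta(z)=O(z^{-4})$ as $z\to0^+$; (iii) $\Delta(z)\,f_\alpha(1/z)=O(z^{-\infty})$ as $z\to+\infty$, that is, $\Delta(z)\,f_\alpha(1/z)=O(z^{-N})$ as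 $z\to+\infty$ for every $N\in\mathbb N$. -/

import Mathlib

open Set Filter Topology MeasureTheory Asymptotics

/-- `μ` is the law of the positive `α`-stable random variable (`0 < α < 1`), in the standard
normalization: a probability measure concentrated on `(0, ∞)` whose Laplace transform is
`∫ exp (-l x) μ(dx) = exp (-l ^ α)` for every `l ≥ 0`. -/
structure IsPositiveStableLaw (α : ℝ) (μ : Measure ℝ) : Prop where
  isProbabilityMeasure : IsProbabilityMeasure μ
  pos : ∀ᵐ x ∂μ, 0 < x
  laplace : ∀ l : ℝ, 0 ≤ l → ∫ x, Real.exp (-(l * x)) ∂μ = Real.exp (-(l ^ α))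

/-- `f` is the density `f_α` of the positive `α`-stable random variable: the nonnegative function,
continuous on `(0, ∞)`, such that `f(x) dx` on `(0, ∞)` is the positive `α`-stable law. The law is
determined by its Laplace transform, hence `f` is determined at every point of `(0, ∞)`.
The values of `f` outside `(0, ∞)` are irrelevant. -/
structure IsPositiveStableDensity (α : ℝ) (f : ℝ → ℝ) : Prop where
  nonneg : ∀ x : ℝ, 0 < x → 0 ≤ f x
  continuousOn : ContinuousOn f (Ioi 0)
  isLaw : IsPositiveStableLaw α
    ((volume.restrict (Ioi (0 : ℝ))).withDensity (fun x => ENNReal.ofReal (f x)))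

/-- The phase `φ_z(y) = z y - log y`. -/
noncomputable def laplacePhase (z y : ℝ) : ℝ := z * y - Real.log y

/-- The Laplace integral `I_n(z) = ∫_0^∞ exp (-n φ_z(y)) f(y) dy`. -/
noncomputable def laplaceIntegral (f : ℝ → ℝ) (n : ℕ) (z : ℝ) : ℝ :=
  ∫ y in Ioi (0 : ℝ), Real.exp (-((n : ℝ) * laplacePhase z y)) * f y

open ProbabilityTheory FourierTransform
open scoped ContDiff

/-! With x = 1/z, the substitution t = zy turns the integral into x^(n+1) ∫ t^n e^(-nt) f(xt) dt.
The weight is an unnormalized Gamma law concentrating at t = 1: its mass n!/n^(n+1) is given by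
Stirling, and its normalized first and second moments about 1 are O(1/n). Expanding f(xt) to first
order at t = 1 therefore leaves, after normalization, an error O(x^(N+2)/n) for every N
(`gammaDeviation_le`). Dividing by f(x) produces Δ: the case N = 0 with f(x) ≥ c/x² at infinity
gives O(z^(-4)), and in Δ(z) f(1/z) the denominator cancels, leaving only flat terms.

It remains to see that f is admissible (`isLaplaceAdmissible`). Analytic continuation of the Laplace
transform to the imaginary axis shows that the characteristic function decays like exp(-c|t|^α). By
Fourier inversion f extends to a smooth function with bounded derivatives, zero on the negative
axis, hence flat at 0. Positivity and the lower bound at infinity come from differentiating the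
Laplace transform: x f(x) is a convolution of f with a multiple of x^(-α), proved here after an
exponential tilt (`sizeBiased_eq_conv`). -/

/-! ### Moments of the Gamma weight. -/

lemma integrableOn_pow_mul_exp_neg_mul (m : ℕ) {r : ℝ} (hr : 0 < r) :
    IntegrableOn (fun t : ℝ => t ^ m * Real.exp (-(r * t))) (Ioi 0) := by
  have h := integrableOn_rpow_mul_exp_neg_mul_rpow (p := 1) (s := m) (b := r)
    (by have : (0 : ℝ) ≤ m := m.cast_nonneg
        linarith) one_pos hr
  simpa [Real.rpow_natCast] using h

lemma integral_pow_mul_exp_neg_mul (m : ℕ) {r : ℝ} (hr : 0 < r) :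
    ∫ t in Ioi (0 : ℝ), t ^ m * Real.exp (-(r * t)) = (m.factorial : ℝ) / r ^ (m + 1) := by
  have h := Real.integral_rpow_mul_exp_neg_mul_Ioi (a := m + 1) (r := r) (by positivity) hr
  rw [Real.Gamma_nat_eq_factorial] at h
  simp only [add_sub_cancel_right, Real.rpow_natCast] at h
  rw [h, ← Nat.cast_succ, Real.rpow_natCast, one_div, inv_pow, div_eq_inv_mul]

/-- The unnormalized Gamma weight `t ^ n * exp (-n t)`. -/
noncomputable def gammaWeight (n : ℕ) (t : ℝ) : ℝ := t ^ n * Real.exp (-(n * t))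

/-- The total mass of `gammaWeight n`. -/
noncomputable def gammaMass (n : ℕ) : ℝ := (n.factorial : ℝ) / (n : ℝ) ^ (n + 1)

lemma gammaWeight_nonneg (n : ℕ) {t : ℝ} (ht : 0 ≤ t) : 0 ≤ gammaWeight n t := by
  unfold gammaWeight; positivity

lemma gammaMass_pos {n : ℕ} (hn : 1 ≤ n) : 0 < gammaMass n := by
  have : (0 : ℝ) < n := by exact_mod_cast hn
  unfold gammaMass; positivity

lemma integrableOn_gammaWeight_mul_pow {n : ℕ} (hn : 1 ≤ n) (k : ℕ) :
    IntegrableOn (fun t => gammaWeight n t * t ^ k) (Ioi 0) := by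
  have hn' : (0 : ℝ) < n := by exact_mod_cast hn
  refine (integrableOn_pow_mul_exp_neg_mul (n + k) hn').congr_fun (fun t _ => ?_) measurableSet_Ioi
  simp only [gammaWeight, pow_add]; ring

lemma integral_gammaWeight_mul_pow {n : ℕ} (hn : 1 ≤ n) (k : ℕ) :
    ∫ t in Ioi (0 : ℝ), gammaWeight n t * t ^ k
      = ((n + k).factorial : ℝ) / (n : ℝ) ^ (n + k + 1) := by
  have hn' : (0 : ℝ) < n := by exact_mod_cast hn
  rw [← integral_pow_mul_exp_neg_mul (n + k) hn']
  refine setIntegral_congr_fun measurableSet_Ioi (fun t _ => ?_)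
  simp only [gammaWeight, pow_add]; ring

lemma integrableOn_gammaWeight {n : ℕ} (hn : 1 ≤ n) : IntegrableOn (gammaWeight n) (Ioi 0) := by
  simpa using integrableOn_gammaWeight_mul_pow hn 0

lemma integral_gammaWeight {n : ℕ} (hn : 1 ≤ n) :
    ∫ t in Ioi (0 : ℝ), gammaWeight n t = gammaMass n := by
  simpa [gammaMass] using integral_gammaWeight_mul_pow hn 0

lemma integral_gammaWeight_mul_sub_one {n : ℕ} (hn : 1 ≤ n) :
    ∫ t in Ioi (0 : ℝ), gammaWeight n t * (t - 1) = gammaMass n / n := by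
  have hn' : (0 : ℝ) < n := by exact_mod_cast hn
  have h1 := integrableOn_gammaWeight_mul_pow hn 1
  have h0 := integrableOn_gammaWeight hn
  have e : ∀ t : ℝ, gammaWeight n t * (t - 1) = gammaWeight n t * t ^ 1 - gammaWeight n t :=
    fun t => by ring
  simp_rw [e]
  rw [integral_sub h1 h0, integral_gammaWeight_mul_pow hn, integral_gammaWeight hn, gammaMass,
    Nat.factorial_succ]
  push_cast
  field_simp
  ring

/-- Each factor satisfies n + j ≤ (j + 1) n because n ≥ 1. -/
lemma factorial_add_le {n : ℕ} (hn : 1 ≤ n) (k : ℕ) :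
    (n + k).factorial ≤ n.factorial * (k + 1).factorial * n ^ k := by
  induction k with
  | zero => simp
  | succ k ih =>
    rw [← add_assoc, Nat.factorial_succ (n + k), Nat.factorial_succ (k + 1), pow_succ]
    calc (n + k + 1) * (n + k).factorial
        ≤ ((k + 1 + 1) * n) * (n.factorial * (k + 1).factorial * n ^ k) := by
          gcongr
          nlinarith
      _ = _ := by ring

lemma integrableOn_gammaWeight_mul_sq {n : ℕ} (hn : 1 ≤ n) (k : ℕ) :
    IntegrableOn (fun t => gammaWeight n t * ((t - 1) ^ 2 * t ^ k)) (Ioi 0) := by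
  have h2 := integrableOn_gammaWeight_mul_pow hn (k + 2)
  have h1 := integrableOn_gammaWeight_mul_pow hn (k + 1)
  have h0 := integrableOn_gammaWeight_mul_pow hn k
  refine ((h2.sub (h1.const_mul 2)).add h0).congr_fun (fun t _ => ?_) measurableSet_Ioi
  simp only [Pi.sub_apply, Pi.add_apply]; ring

lemma integral_gammaWeight_mul_sq_le {n : ℕ} (hn : 1 ≤ n) (k : ℕ) :
    ∫ t in Ioi (0 : ℝ), gammaWeight n t * ((t - 1) ^ 2 * t ^ k)
      ≤ ((k + 1).factorial * ((k + 1) ^ 2 + k + 2) : ℝ) * (gammaMass n / n) := by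
  have hn' : (1 : ℝ) ≤ n := by exact_mod_cast hn
  have hn0 : (0 : ℝ) < n := by linarith
  have h2 := integrableOn_gammaWeight_mul_pow hn (k + 2)
  have h1 := integrableOn_gammaWeight_mul_pow hn (k + 1)
  have h0 := integrableOn_gammaWeight_mul_pow hn k
  have e : ∀ t : ℝ, gammaWeight n t * ((t - 1) ^ 2 * t ^ k) =
      gammaWeight n t * t ^ (k + 2) - 2 * (gammaWeight n t * t ^ (k + 1))
        + gammaWeight n t * t ^ k := fun t => by ring
  have h21 : IntegrableOn (fun t => gammaWeight n t * t ^ (k + 2)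
      - 2 * (gammaWeight n t * t ^ (k + 1))) (Ioi 0) := h2.sub (h1.const_mul 2)
  simp_rw [e]
  rw [integral_add h21 h0, integral_sub h2 (h1.const_mul 2),
    integral_const_mul, integral_gammaWeight_mul_pow hn, integral_gammaWeight_mul_pow hn,
    integral_gammaWeight_mul_pow hn]
  have hf : ((n + k).factorial : ℝ) ≤ n.factorial * (k + 1).factorial * (n : ℝ) ^ k := by
    exact_mod_cast factorial_add_le hn k
  -- The n² terms cancel: (n+k+2)(n+k+1) - 2n(n+k+1) + n² is linear in n, which is the source of the
  -- gain 1/n.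
  have : ((n + (k + 2)).factorial : ℝ) / (n : ℝ) ^ (n + (k + 2) + 1)
      - 2 * (((n + (k + 1)).factorial : ℝ) / (n : ℝ) ^ (n + (k + 1) + 1))
      + ((n + k).factorial : ℝ) / (n : ℝ) ^ (n + k + 1)
      = ((n + k).factorial : ℝ) * ((k + 1) ^ 2 + n + k + 1) / (n : ℝ) ^ (n + k + 3) := by
    rw [show n + (k + 2) = (n + k + 1) + 1 by ring, Nat.factorial_succ,
      show n + (k + 1) = (n + k) + 1 by ring, Nat.factorial_succ]
    push_cast
    field_simp
    ring
  rw [this]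
  calc ((n + k).factorial : ℝ) * ((k + 1) ^ 2 + n + k + 1) / (n : ℝ) ^ (n + k + 3)
      ≤ (n.factorial * (k + 1).factorial * (n : ℝ) ^ k) * (((k + 1) ^ 2 + k + 2) * n)
          / (n : ℝ) ^ (n + k + 3) := by
        gcongr
        nlinarith [sq_nonneg ((k : ℝ) + 1), (Nat.cast_nonneg k : (0 : ℝ) ≤ k),
          mul_le_mul_of_nonneg_left hn' (by positivity : (0 : ℝ) ≤ (k + 1) ^ 2 + k + 1)]
    _ = _ := by
        unfold gammaMass
        field_simp
        ring

/-! ### Stirling's formula with error term. -/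

/-- The decrements of log `stirlingSeq` are at most 1/(12k(k+1)), which telescopes; so log
`stirlingSeq` n - 1/(12n) increases to its limit log √π. -/
lemma stirlingSeq_le {n : ℕ} (hn : 1 ≤ n) :
    Stirling.stirlingSeq n ≤ √Real.pi * Real.exp (1 / (12 * n)) := by
  have hanti : Monotone fun k : ℕ => Real.log (Stirling.stirlingSeq (k + 1)) - 1 / (12 * (k + 1)) := by
    refine monotone_nat_of_le_succ fun k => ?_
    have h := Stirling.log_stirlingSeq_sdiff_le (k + 1)
    push_cast at h ⊢
    have : (1 : ℝ) / (12 * (k + 1)) - 1 / (12 * (k + 1 + 1)) = 1 / (12 * (k + 1) * (k + 1 + 1)) := by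
      field_simp
      ring
    linarith
  have hlim : Tendsto (fun k : ℕ => Real.log (Stirling.stirlingSeq (k + 1)) - 1 / (12 * ((k : ℝ) + 1)))
      atTop (𝓝 (Real.log (√Real.pi) - 0)) := by
    refine Tendsto.sub ?_ ?_
    · refine Tendsto.log ?_ (by positivity)
      exact Stirling.tendsto_stirlingSeq_sqrt_pi.comp (tendsto_add_atTop_nat 1)
    · have := (tendsto_one_div_add_atTop_nhds_zero_nat (𝕜 := ℝ)).const_mul (1 / 12)
      rw [mul_zero] at this
      refine this.congr fun k => ?_
      field_simp
  obtain ⟨m, rfl⟩ : ∃ m, n = m + 1 := ⟨n - 1, by omega⟩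
  have h := hanti.ge_of_tendsto hlim m
  have hpos := Stirling.stirlingSeq'_pos m
  rw [← Real.exp_log hpos, ← Real.exp_log (show 0 < √Real.pi by positivity), ← Real.exp_add]
  push_cast
  exact Real.exp_le_exp.2 (by linarith)

/-- Stirling's formula with a relative error of order `1 / n`. -/
lemma gammaMass_stirling {n : ℕ} (hn : 1 ≤ n) :
    Real.exp (-(n : ℝ)) * √(2 * Real.pi / n) ≤ gammaMass n ∧
    gammaMass n ≤ Real.exp (-(n : ℝ)) * √(2 * Real.pi / n) * (1 + 1 / n) := by
  have hn' : (1 : ℝ) ≤ n := by exact_mod_cast hn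
  have hn0 : (0 : ℝ) < n := by linarith
  have hm : gammaMass n * √Real.pi =
      Stirling.stirlingSeq n * (Real.exp (-(n : ℝ)) * √(2 * Real.pi / n)) := by
    unfold gammaMass Stirling.stirlingSeq
    have h1 : √(2 * Real.pi / n) = √(2 * n) * √Real.pi / n := by
      rw [← Real.sqrt_mul (by positivity), show 2 * Real.pi / n = (2 * n * Real.pi) / n ^ 2 by
        field_simp, Real.sqrt_div (by positivity), Real.sqrt_sq hn0.le]
    rw [h1, div_pow, ← Real.exp_nat_mul, mul_one, Real.exp_neg]
    field_simp
    ring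
  have hpi : 0 < √Real.pi := by positivity
  have hE : 0 < Real.exp (-(n : ℝ)) * √(2 * Real.pi / n) := by positivity
  constructor
  · refine le_of_mul_le_mul_right ?_ hpi
    rw [hm, mul_comm]
    exact mul_le_mul_of_nonneg_right (Stirling.sqrt_pi_le_stirlingSeq (by omega)) hE.le
  · refine le_of_mul_le_mul_right ?_ hpi
    rw [hm]
    have h2 : Real.exp (1 / (12 * (n : ℝ))) ≤ 1 + 1 / n := by
      have hx0 : 0 ≤ 1 / (12 * (n : ℝ)) := by positivity
      have hx1 : 1 / (12 * (n : ℝ)) ≤ 1 := by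
        rw [div_le_one (by positivity)]; linarith
      have h3 := Real.abs_exp_sub_one_sub_id_le (x := 1 / (12 * (n : ℝ)))
        (by rw [abs_of_nonneg hx0]; exact hx1)
      have h4 := (abs_le.1 h3).2
      have h5 : (1 : ℝ) / n = 12 * (1 / (12 * (n : ℝ))) := by field_simp
      rw [h5]
      nlinarith
    calc _ ≤ (√Real.pi * (1 + 1 / n)) * (Real.exp (-(n : ℝ)) * √(2 * Real.pi / n)) := by
          gcongr
          exact (stirlingSeq_le hn).trans (by gcongr)
      _ = _ := by ring

/-- A monotone function is dominated by a continuous one that is bounded by its dilate. -/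
lemma exists_continuousOn_envelope {h : ℝ → ℝ} (hm : MonotoneOn h (Ioi 0)) :
    ∃ H : ℝ → ℝ, ContinuousOn H (Ioi 0) ∧ ∀ x, 0 < x → h x ≤ H x ∧ H x ≤ h (2 * x) := by
  have hint : ∀ a b : ℝ, 0 < a → 0 < b → IntervalIntegrable h volume a b := fun a b ha hb =>
    (hm.mono fun y hy => (lt_min ha hb).trans_le hy.1).intervalIntegrable
  have hprim : ContinuousOn (fun x => ∫ t in (1 : ℝ)..x, h t) (Ioi 0) := by
    intro x hx
    have hx : 0 < x := hx
    refine ContinuousAt.continuousWithinAt ?_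
    have hc := intervalIntegral.continuousOn_primitive_interval' (a := 1)
      (hint (min (x / 2) 1) (max (2 * x) 1) (by positivity) (by positivity))
      (by rw [uIcc_of_le ((min_le_right _ _).trans (le_max_right _ _))]
          exact ⟨min_le_right _ _, le_max_right _ _⟩)
    refine hc.continuousAt ?_
    rw [uIcc_of_le ((min_le_right _ _).trans (le_max_right _ _))]
    refine Icc_mem_nhds ?_ ?_
    · exact (min_le_left _ _).trans_lt (by linarith)
    · exact lt_of_lt_of_le (by linarith) (le_max_left _ _)
  -- The mean of h over [x, 2x] is continuous, and monotonicity places it between h x and h (2x).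
  refine ⟨fun x => x⁻¹ * ((∫ t in (1 : ℝ)..(2 * x), h t) - ∫ t in (1 : ℝ)..x, h t), ?_, ?_⟩
  · refine ContinuousOn.mul (continuousOn_inv₀.mono fun x hx => ne_of_gt hx) (ContinuousOn.sub ?_ hprim)
    exact hprim.comp (by fun_prop) fun x hx => by
      have : 0 < x := hx
      exact mem_Ioi.2 (by linarith)
  · intro x hx
    have e : (∫ t in (1 : ℝ)..(2 * x), h t) - ∫ t in (1 : ℝ)..x, h t = ∫ t in x..(2 * x), h t :=
      intervalIntegral.integral_interval_sub_left (hint _ _ one_pos (by linarith))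
        (hint _ _ one_pos hx)
    simp only [e]
    have hxx : x ≤ 2 * x := by linarith
    have hi := hint x (2 * x) hx (by linarith)
    constructor
    · have := intervalIntegral.integral_mono_on hxx (intervalIntegrable_const (c := h x)) hi
        (fun t ht => hm hx (hx.trans_le ht.1) ht.1)
      rw [intervalIntegral.integral_const, smul_eq_mul] at this
      rw [inv_mul_eq_div, le_div_iff₀ hx]
      linarith
    · have := intervalIntegral.integral_mono_on hxx hi (intervalIntegrable_const (c := h (2 * x)))
        (fun t ht => hm (hx.trans_le ht.1) (mem_Ioi.2 (by linarith)) ht.2)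
      rw [intervalIntegral.integral_const, smul_eq_mul] at this
      rw [inv_mul_eq_div, div_le_iff₀ hx]
      linarith

/-! ### Laplace's method for admissible densities. -/

/-- The properties of a density on `(0, ∞)` under which Laplace's method applies uniformly: it is
positive and continuous, flat at `0`, it decays at most quadratically at infinity, and it has a
first order Taylor expansion whose coefficients and remainder are flat at `0`. -/
structure IsLaplaceAdmissible (f : ℝ → ℝ) : Prop where
  continuousOn : ContinuousOn f (Ioi 0)
  pos : ∀ x, 0 < x → 0 < f x
  flat : ∀ N : ℕ, ∃ C, ∀ x, 0 < x → f x ≤ C * x ^ N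
  lower : ∃ c X : ℝ, 0 < c ∧ ∀ x, X ≤ x → c ≤ x ^ 2 * f x
  taylor : ∀ N : ℕ, ∃ C, ∀ x, 0 < x → ∃ a : ℝ, |a| ≤ C * x ^ (N + 2) ∧
    ∀ t, 0 < t → |f (x * t) - f x - a * (t - 1)| ≤ C * x ^ (N + 2) * ((t - 1) ^ 2 * (1 + t ^ N))

/-- The average of `f (x t)` against the unnormalized Gamma weight. -/
noncomputable def gammaAverage (f : ℝ → ℝ) (n : ℕ) (x : ℝ) : ℝ :=
  ∫ t in Ioi (0 : ℝ), gammaWeight n t * f (x * t)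

/-- The deviation of the normalized Gamma average of `f (x t)` from `f x`, multiplied by `n`. -/
noncomputable def gammaDeviation (f : ℝ → ℝ) (n : ℕ) (x : ℝ) : ℝ :=
  n * |gammaAverage f n x - gammaMass n * f x| / gammaMass n

namespace IsLaplaceAdmissible

variable {f : ℝ → ℝ}

lemma exists_bound (hf : IsLaplaceAdmissible f) : ∃ C, ∀ x, 0 < x → |f x| ≤ C := by
  obtain ⟨C, hC⟩ := hf.flat 0
  exact ⟨C, fun x hx => by simpa [abs_of_pos (hf.pos x hx)] using hC x hx⟩

lemma aestronglyMeasurable_comp_mul (hf : IsLaplaceAdmissible f) (n : ℕ) {x : ℝ} (hx : 0 < x) :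
    AEStronglyMeasurable (fun t => gammaWeight n t * f (x * t)) (volume.restrict (Ioi 0)) := by
  refine ContinuousOn.aestronglyMeasurable (ContinuousOn.mul ?_ ?_) measurableSet_Ioi
  · unfold gammaWeight; fun_prop
  · exact hf.continuousOn.comp (by fun_prop) fun t ht => mul_pos hx ht

lemma integrableOn_gammaWeight_mul (hf : IsLaplaceAdmissible f) {n : ℕ} (hn : 1 ≤ n) {x : ℝ}
    (hx : 0 < x) : IntegrableOn (fun t => gammaWeight n t * f (x * t)) (Ioi 0) := by
  obtain ⟨C, hC⟩ := hf.exists_bound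
  refine ((integrableOn_gammaWeight hn).mul_const C).mono' (hf.aestronglyMeasurable_comp_mul n hx) ?_
  refine (ae_restrict_iff' measurableSet_Ioi).2 (Eventually.of_forall fun t ht => ?_)
  have ht : 0 < t := ht
  rw [Real.norm_eq_abs, abs_mul, abs_of_nonneg (gammaWeight_nonneg n ht.le)]
  exact mul_le_mul_of_nonneg_left (hC _ (mul_pos hx ht)) (gammaWeight_nonneg n ht.le)

lemma continuousOn_gammaAverage (hf : IsLaplaceAdmissible f) {n : ℕ} (hn : 1 ≤ n) :
    ContinuousOn (gammaAverage f n) (Ioi 0) := by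
  obtain ⟨C, hC⟩ := hf.exists_bound
  refine continuousOn_of_dominated (bound := fun t => gammaWeight n t * C)
    (fun x hx => hf.aestronglyMeasurable_comp_mul n hx) (fun x hx => ?_)
    ((integrableOn_gammaWeight hn).mul_const C) ?_
  · refine (ae_restrict_iff' measurableSet_Ioi).2 (Eventually.of_forall fun t ht => ?_)
    have ht : 0 < t := ht
    rw [Real.norm_eq_abs, abs_mul, abs_of_nonneg (gammaWeight_nonneg n ht.le)]
    exact mul_le_mul_of_nonneg_left (hC _ (mul_pos hx ht)) (gammaWeight_nonneg n ht.le)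
  · refine (ae_restrict_iff' measurableSet_Ioi).2 (Eventually.of_forall fun t ht => ?_)
    exact continuousOn_const.mul (hf.continuousOn.comp (by fun_prop) fun x hx => mem_Ioi.2 (mul_pos hx ht))

/-- The linear Taylor term integrates to a · `gammaMass` n / n, and the remainder is controlled by
the second moments with k = 0 and k = N, which supply the constants `A 0` and `A N`. -/
lemma gammaDeviation_le (hf : IsLaplaceAdmissible f) (N : ℕ) :
    ∃ C, ∀ n, 1 ≤ n → ∀ x, 0 < x → gammaDeviation f n x ≤ C * x ^ (N + 2) := by
  obtain ⟨C, hC⟩ := hf.taylor N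
  have hC0 : 0 ≤ C := by
    obtain ⟨a, ha, -⟩ := hC 1 one_pos
    simpa using (abs_nonneg a).trans ha
  set A : ℕ → ℝ := fun k => ((k + 1).factorial * ((k + 1) ^ 2 + k + 2) : ℝ) with hA
  refine ⟨C * (1 + (A 0 + A N)), fun n hn x hx => ?_⟩
  have hn0 : (0 : ℝ) < n := by exact_mod_cast hn
  have hm := gammaMass_pos hn
  obtain ⟨a, ha, hR⟩ := hC x hx
  have hw := integrableOn_gammaWeight hn
  have hw1 : IntegrableOn (fun t => gammaWeight n t * (t - 1)) (Ioi 0) :=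
    ((integrableOn_gammaWeight_mul_pow hn 1).sub hw).congr_fun
      (fun t _ => by simp only [Pi.sub_apply]; ring) measurableSet_Ioi
  have hK := hf.integrableOn_gammaWeight_mul hn hx
  have hsplit : ∫ t in Ioi (0 : ℝ), gammaWeight n t * (f (x * t) - f x - a * (t - 1))
      = gammaAverage f n x - gammaMass n * f x - a * (gammaMass n / n) := by
    have e : ∀ t, gammaWeight n t * (f (x * t) - f x - a * (t - 1))
        = gammaWeight n t * f (x * t) - gammaWeight n t * f x - a * (gammaWeight n t * (t - 1)) :=
      fun t => by ring
    have h1 : IntegrableOn (fun t => gammaWeight n t * f (x * t) - gammaWeight n t * f x) (Ioi 0) :=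
      hK.sub (hw.mul_const _)
    simp_rw [e]
    rw [integral_sub h1 (hw1.const_mul a), integral_sub hK (hw.mul_const _), integral_const_mul,
      integral_mul_const, integral_gammaWeight hn, integral_gammaWeight_mul_sub_one hn, gammaAverage]
  have h2 := integrableOn_gammaWeight_mul_sq hn 0
  have h2N := integrableOn_gammaWeight_mul_sq hn N
  have hrem : |∫ t in Ioi (0 : ℝ), gammaWeight n t * (f (x * t) - f x - a * (t - 1))|
      ≤ C * x ^ (N + 2) * ((A 0 + A N) * (gammaMass n / n)) := by
    rw [← Real.norm_eq_abs]
    refine (norm_integral_le_of_norm_le (((h2.add h2N).const_mul (C * x ^ (N + 2)))) ?_).trans ?_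
    · refine (ae_restrict_iff' measurableSet_Ioi).2 (Eventually.of_forall fun t ht => ?_)
      have ht : 0 < t := ht
      rw [Real.norm_eq_abs, abs_mul, abs_of_nonneg (gammaWeight_nonneg n ht.le)]
      refine (mul_le_mul_of_nonneg_left (hR t ht) (gammaWeight_nonneg n ht.le)).trans_eq ?_
      simp only [Pi.add_apply]
      ring
    · rw [integral_const_mul]
      refine mul_le_mul_of_nonneg_left ?_ (by positivity)
      simp only [Pi.add_apply]
      rw [integral_add h2 h2N, add_mul]
      exact add_le_add (by simpa [hA] using integral_gammaWeight_mul_sq_le hn 0)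
        (integral_gammaWeight_mul_sq_le hn N)
  have htot : |gammaAverage f n x - gammaMass n * f x|
      ≤ C * (1 + (A 0 + A N)) * x ^ (N + 2) * (gammaMass n / n) := by
    rw [hsplit] at hrem
    have h3 : |a * (gammaMass n / n)| ≤ C * x ^ (N + 2) * (gammaMass n / n) := by
      rw [abs_mul, abs_of_pos (div_pos hm hn0)]
      exact mul_le_mul_of_nonneg_right ha (div_pos hm hn0).le
    have h4 := abs_add_le (gammaAverage f n x - gammaMass n * f x - a * (gammaMass n / n))
      (a * (gammaMass n / n))
    rw [sub_add_cancel] at h4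
    linarith
  rw [gammaDeviation, div_le_iff₀ hm]
  calc n * |gammaAverage f n x - gammaMass n * f x|
      ≤ n * (C * (1 + (A 0 + A N)) * x ^ (N + 2) * (gammaMass n / n)) := by gcongr
    _ = _ := by field_simp

/-- A continuous flat bound for the deviations, uniform in `n`. -/
lemma exists_deviation_bound (hf : IsLaplaceAdmissible f) :
    ∃ H : ℝ → ℝ, ContinuousOn H (Ioi 0) ∧
      (∀ n, 1 ≤ n → ∀ x, 0 < x → gammaDeviation f n x ≤ H x) ∧
      ∀ N : ℕ, ∃ C, ∀ x, 0 < x → H x ≤ C * x ^ (N + 2) := by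
  -- Taking all u ≤ x, not only u = x, makes the supremum monotone in x, as the continuous envelope
  -- requires; it is finite because the deviation bounds are uniform in n.
  set S : ℝ → Set ℝ := fun x => {r | ∃ n, 1 ≤ n ∧ ∃ u, 0 < u ∧ u ≤ x ∧ r = gammaDeviation f n u}
  have hdev0 : ∀ n, 1 ≤ n → ∀ x, 0 ≤ gammaDeviation f n x := fun n hn x => by
    have := gammaMass_pos hn
    unfold gammaDeviation
    positivity
  have hS : ∀ N : ℕ, ∃ C, ∀ x, 0 < x → ∀ r ∈ S x, r ≤ C * x ^ (N + 2) := by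
    intro N
    obtain ⟨C, hC⟩ := hf.gammaDeviation_le N
    have hC0 : 0 ≤ C := by simpa using (hdev0 1 le_rfl 1).trans (hC 1 le_rfl 1 one_pos)
    refine ⟨C, fun x hx r hr => ?_⟩
    obtain ⟨n, hn, u, hu, hux, rfl⟩ := hr
    exact (hC n hn u hu).trans (by gcongr)
  have hne : ∀ x, 0 < x → (S x).Nonempty := fun x hx => ⟨_, 1, le_rfl, x, hx, le_rfl, rfl⟩
  have hbdd : ∀ x, 0 < x → BddAbove (S x) := fun x hx => by
    obtain ⟨C, hC⟩ := hS 0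
    exact ⟨_, hC x hx⟩
  obtain ⟨H, hHc, hH⟩ := exists_continuousOn_envelope (h := fun x => sSup (S x))
    (fun x hx y hy hxy => csSup_le_csSup (hbdd y hy) (hne x hx) fun r hr => by
      obtain ⟨n, hn, u, hu, hux, rfl⟩ := hr
      exact ⟨n, hn, u, hu, hux.trans hxy, rfl⟩)
  refine ⟨H, hHc, fun n hn x hx => ?_, fun N => ?_⟩
  · exact (le_csSup (hbdd x hx) ⟨n, hn, x, hx, le_rfl, rfl⟩).trans (hH x hx).1
  · obtain ⟨C, hC⟩ := hS N
    refine ⟨C * 2 ^ (N + 2), fun x hx => (hH x hx).2.trans ?_⟩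
    have h2x : 0 < 2 * x := by linarith
    refine (csSup_le (hne _ h2x) (hC _ h2x)).trans_eq ?_
    rw [mul_pow]; ring

end IsLaplaceAdmissible

lemma exp_laplacePhase {z y : ℝ} (n : ℕ) (hy : 0 < y) :
    Real.exp (-((n : ℝ) * laplacePhase z y)) = y ^ n * Real.exp (-(n * (z * y))) := by
  rw [laplacePhase, show -((n : ℝ) * (z * y - Real.log y)) = n * Real.log y + -(n * (z * y)) by ring,
    Real.exp_add, Real.exp_nat_mul, Real.exp_log hy]

/-- The scaling t = zy moves the minimum of the phase from y = 1/z to t = 1, so that z survives only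
inside f. -/
lemma exp_laplacePhase_mul_eq (f : ℝ → ℝ) {z y : ℝ} (n : ℕ) (hz : 0 < z) (hy : 0 < y) :
    Real.exp (-((n : ℝ) * laplacePhase z y)) * f y
      = (1 / z) ^ n * (gammaWeight n (z * y) * f (1 / z * (z * y))) := by
  rw [exp_laplacePhase n hy, gammaWeight, mul_pow, ← mul_assoc (1 / z) z y, one_div_mul_cancel hz.ne',
    one_mul, one_div, inv_pow]
  field_simp

lemma integrableOn_exp_laplacePhase_mul {f : ℝ → ℝ} (hf : IsLaplaceAdmissible f) {n : ℕ}
    (hn : 1 ≤ n) {z : ℝ} (hz : 0 < z) :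
    IntegrableOn (fun y : ℝ => Real.exp (-((n : ℝ) * laplacePhase z y)) * f y) (Ioi 0) := by
  have h := hf.integrableOn_gammaWeight_mul hn (one_div_pos.2 hz)
  have h' : IntegrableOn (fun y => gammaWeight n (z * y) * f (1 / z * (z * y))) (Ioi 0) := by
    have := (integrableOn_Ioi_comp_mul_left_iff
      (fun t => gammaWeight n t * f (1 / z * t)) 0 hz).2 (by simpa using h)
    simpa using this
  exact IntegrableOn.congr_fun (h'.const_mul ((1 / z) ^ n))
    (fun y hy => (exp_laplacePhase_mul_eq f n hz hy).symm) measurableSet_Ioi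

lemma laplaceIntegral_eq_gammaAverage (f : ℝ → ℝ) (n : ℕ) {z : ℝ} (hz : 0 < z) :
    laplaceIntegral f n z = (1 / z) ^ (n + 1) * gammaAverage f n (1 / z) := by
  rw [laplaceIntegral, setIntegral_congr_fun measurableSet_Ioi
    (fun y hy => exp_laplacePhase_mul_eq f n hz hy), integral_const_mul,
    integral_comp_mul_left_Ioi (fun t => gammaWeight n t * f (1 / z * t)) 0 hz, gammaAverage,
    mul_zero, smul_eq_mul, pow_succ, one_div]
  ring

/-- Laplace's method for admissible densities, uniformly in the parameter. -/
theorem IsLaplaceAdmissible.laplace_expansion {f : ℝ → ℝ} (hf : IsLaplaceAdmissible f) :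
    ∃ Δ : ℝ → ℝ,
      ContinuousOn Δ (Ioi 0) ∧
      (∀ z : ℝ, 0 < z → 0 < Δ z) ∧
      (Δ =O[𝓝[>] (0 : ℝ)] fun z : ℝ => (z ^ 4)⁻¹) ∧
      (∀ N : ℕ, (fun z : ℝ => Δ z * f (1 / z)) =O[atTop] fun z : ℝ => (z ^ N)⁻¹) ∧
      ∀ n : ℕ, 1 ≤ n →
        ∃ δ : ℝ → ℝ,
          ContinuousOn δ (Ioi 0) ∧
          ∀ z : ℝ, 0 < z →
            IntegrableOn (fun y : ℝ => Real.exp (-((n : ℝ) * laplacePhase z y)) * f y) (Ioi 0) ∧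
            laplaceIntegral f n z =
              (1 / z) ^ (n + 1) * f (1 / z) * Real.exp (-(n : ℝ)) *
                Real.sqrt (2 * Real.pi / (n : ℝ)) * (1 + δ z) ∧
            |δ z| ≤ Δ z / (n : ℝ) := by
  obtain ⟨H, hHc, hdev, hflat⟩ := hf.exists_deviation_bound
  have hinv : ContinuousOn (fun z : ℝ => 1 / z) (Ioi 0) :=
    continuousOn_const.div continuousOn_id fun z hz => ne_of_gt hz
  have hmaps : MapsTo (fun z : ℝ => 1 / z) (Ioi 0) (Ioi 0) := fun z hz => mem_Ioi.2 (one_div_pos.2 hz)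
  have hfc : ContinuousOn (fun z => f (1 / z)) (Ioi 0) := hf.continuousOn.comp hinv hmaps
  have hfpos : ∀ z : ℝ, 0 < z → 0 < f (1 / z) := fun z hz => hf.pos _ (one_div_pos.2 hz)
  have hH0 : ∀ x, 0 < x → 0 ≤ H x := fun x hx => by
    refine le_trans ?_ (hdev 1 le_rfl x hx)
    have := gammaMass_pos (n := 1) le_rfl
    unfold gammaDeviation
    positivity
  -- The 1 absorbs the Stirling error; 2H/f absorbs the deviation, the factor 2 coming from
  -- `gammaMass n ≤ 2 * E`.
  refine ⟨fun z => 1 + 2 * H (1 / z) / f (1 / z), ?_, ?_, ?_, ?_, ?_⟩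
  · exact continuousOn_const.add ((continuousOn_const.mul (hHc.comp hinv hmaps)).div hfc
      fun z hz => (hfpos z hz).ne')
  · intro z hz
    have h1 := hH0 _ (one_div_pos.2 hz)
    have h2 := hfpos z hz
    positivity
  · obtain ⟨C, hC⟩ := hflat 0
    obtain ⟨c, X, hc, hX⟩ := hf.lower
    refine IsBigO.of_bound (1 + 2 * C / c) ?_
    have hsmall : ∀ᶠ z : ℝ in 𝓝[>] 0, z < min 1 (1 / max X 1) :=
      mem_nhdsWithin_of_mem_nhds (Iio_mem_nhds (by positivity))
    filter_upwards [self_mem_nhdsWithin, hsmall] with z hz hzs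
    have hz : 0 < z := hz
    have hz1 : z < 1 := hzs.trans_le (min_le_left _ _)
    have hzX : X ≤ 1 / z := by
      have := hzs.trans_le (min_le_right _ _)
      rw [lt_div_iff₀ (by positivity), mul_comm, ← lt_div_iff₀ hz] at this
      exact (le_max_left _ _).trans this.le
    have hx := one_div_pos.2 hz
    have hfz := hfpos z hz
    have h1 := hC _ hx
    have h2 := hX _ hzX
    have h0 := hH0 _ hx
    have hC0 : 0 ≤ C := by
      by_contra hneg
      have : C * (1 / z) ^ (0 + 2) < 0 := mul_neg_of_neg_of_pos (not_le.1 hneg) (by positivity)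
      linarith
    rw [Real.norm_of_nonneg (by positivity), Real.norm_of_nonneg (by positivity)]
    have h3 : 2 * H (1 / z) / f (1 / z) ≤ 2 * C / c * (z ^ 4)⁻¹ := by
      rw [div_le_iff₀ hfz]
      calc 2 * H (1 / z) ≤ 2 * (C * (1 / z) ^ (0 + 2)) * 1 := by linarith
        _ ≤ 2 * (C * (1 / z) ^ (0 + 2)) * ((1 / z) ^ 2 * f (1 / z) / c) := by
            gcongr
            rwa [le_div_iff₀ hc, one_mul]
        _ = _ := by
            rw [one_div, zero_add]
            field_simp
    have h4 : 1 ≤ (z ^ 4)⁻¹ := (one_le_inv₀ (by positivity)).2 (pow_le_one₀ hz.le hz1.le)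
    linarith
  · intro N
    obtain ⟨C, hC⟩ := hflat N
    obtain ⟨D, hD⟩ := hf.flat N
    refine IsBigO.of_bound (D + 2 * C) ?_
    filter_upwards [eventually_ge_atTop (1 : ℝ)] with z hz1
    have hz : 0 < z := by linarith
    have hx := one_div_pos.2 hz
    have hx1 : 1 / z ≤ 1 := (div_le_one hz).2 hz1
    have hfz := hfpos z hz
    have h0 := hH0 _ hx
    have hC0 : 0 ≤ C := by
      by_contra hneg
      have : C * (1 / z) ^ (N + 2) < 0 := mul_neg_of_neg_of_pos (not_le.1 hneg) (by positivity)
      linarith [hC _ hx]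
    rw [Real.norm_of_nonneg (by positivity), Real.norm_of_nonneg (by positivity)]
    have e : (1 + 2 * H (1 / z) / f (1 / z)) * f (1 / z) = f (1 / z) + 2 * H (1 / z) := by
      field_simp
    have e2 : (z ^ N)⁻¹ = (1 / z) ^ N := by rw [one_div, inv_pow]
    rw [e, e2]
    have h5 : C * (1 / z) ^ (N + 2) ≤ C * (1 / z) ^ N :=
      mul_le_mul_of_nonneg_left (pow_le_pow_of_le_one hx.le hx1 (by omega)) hC0
    linarith [hC _ hx, hD _ hx]
  · intro n hn
    have hn0 : (0 : ℝ) < n := by exact_mod_cast hn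
    have hn1 : (1 : ℝ) ≤ n := by exact_mod_cast hn
    set E : ℝ := Real.exp (-(n : ℝ)) * √(2 * Real.pi / n) with hE
    have hE0 : 0 < E := by positivity
    obtain ⟨hs1, hs2⟩ := gammaMass_stirling hn
    rw [← hE] at hs1 hs2
    have hm := gammaMass_pos hn
    -- δ is read off from the required identity, so only its size is at stake.
    refine ⟨fun z => gammaAverage f n (1 / z) / (f (1 / z) * E) - 1, ?_, fun z hz => ⟨?_, ?_, ?_⟩⟩
    · exact (((hf.continuousOn_gammaAverage hn).comp hinv hmaps).div
        (hfc.mul continuousOn_const) fun z hz => (mul_pos (hfpos z hz) hE0).ne').sub continuousOn_const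
    · exact integrableOn_exp_laplacePhase_mul hf hn hz
    · have hfz := hfpos z hz
      rw [laplaceIntegral_eq_gammaAverage f n hz, add_sub_cancel,
        mul_assoc ((1 / z) ^ (n + 1) * f (1 / z)), ← hE]
      field_simp
    · have hfz := hfpos z hz
      have hx := one_div_pos.2 hz
      have hd := hdev n hn _ hx
      have h0 := hH0 _ hx
      rw [gammaDeviation, div_le_iff₀ hm] at hd
      have hm2 : gammaMass n ≤ 2 * E := by
        have : (1 : ℝ) / n ≤ 1 := (div_le_one hn0).2 hn1
        nlinarith
      have hmE : |(gammaMass n - E) * f (1 / z)| ≤ E * f (1 / z) / n := by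
        rw [abs_mul, abs_of_pos hfz, abs_of_nonneg (by linarith)]
        have : gammaMass n - E ≤ E / n := by
          have : E * (1 + 1 / (n : ℝ)) = E + E / n := by ring
          linarith
        calc _ ≤ E / n * f (1 / z) := by gcongr
          _ = _ := by ring
      have hK : |gammaAverage f n (1 / z) - gammaMass n * f (1 / z)| ≤ H (1 / z) * (2 * E) / n := by
        rw [le_div_iff₀ hn0, mul_comm]
        exact hd.trans (by gcongr)
      have e : gammaAverage f n (1 / z) / (f (1 / z) * E) - 1
          = ((gammaAverage f n (1 / z) - gammaMass n * f (1 / z))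
            + (gammaMass n - E) * f (1 / z)) / (f (1 / z) * E) := by
        field_simp
        ring
      have hden : 0 < f (1 / z) * E := mul_pos hfz hE0
      beta_reduce
      rw [e, abs_div, abs_of_pos hden, div_le_iff₀ hden]
      refine (abs_add_le _ _).trans ((add_le_add hK hmE).trans_eq ?_)
      field_simp
      ring

/-! ### Analytic continuation of Laplace transforms. -/

section HalfPlane

variable {μ : Measure ℝ} [IsFiniteMeasure μ]

lemma Iic_subset_integrableExpSet (hμ : ∀ᵐ x ∂μ, 0 ≤ x) : Iic 0 ⊆ integrableExpSet id μ := by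
  intro t ht
  have ht : t ≤ 0 := ht
  refine Integrable.of_bound (by fun_prop) 1 ?_
  filter_upwards [hμ] with x hx
  rw [Real.norm_of_nonneg (Real.exp_pos _).le, Real.exp_le_one_iff]
  exact mul_nonpos_of_nonpos_of_nonneg ht hx

lemma Iio_subset_interior_integrableExpSet (hμ : ∀ᵐ x ∂μ, 0 ≤ x) :
    Iio 0 ⊆ interior (integrableExpSet id μ) := by
  have := interior_mono (Iic_subset_integrableExpSet hμ)
  rwa [interior_Iic] at this

lemma analyticOnNhd_complexMGF_halfPlane (hμ : ∀ᵐ x ∂μ, 0 ≤ x) :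
    AnalyticOnNhd ℂ (complexMGF id μ) {z | z.re < 0} :=
  analyticOnNhd_complexMGF.mono fun _ hz => Iio_subset_interior_integrableExpSet hμ hz

/-- A Laplace transform is determined on the open half-plane by its values on the half-line. -/
lemma eqOn_complexMGF_halfPlane (hμ : ∀ᵐ x ∂μ, 0 ≤ x) {g : ℂ → ℂ}
    (hg : AnalyticOnNhd ℂ g {z | z.re < 0})
    (h : ∀ l : ℝ, 0 < l → ((∫ x, Real.exp (-(l * x)) ∂μ : ℝ) : ℂ) = g (-l)) :
    EqOn (complexMGF id μ) g {z | z.re < 0} := by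
  refine AnalyticOnNhd.eqOn_of_preconnected_of_frequently_eq
    (analyticOnNhd_complexMGF_halfPlane hμ) hg (convex_halfSpace_re_lt 0).isPreconnected
    (z₀ := ((-1 : ℝ) : ℂ)) (by simp) ?_
  -- The hypothesis concerns real points only; they accumulate at -1, which is enough for the
  -- identity theorem.
  have h_real : ∃ᶠ x : ℝ in 𝓝[≠] (-1), complexMGF id μ x = g x := by
    have : ∀ᶠ x : ℝ in 𝓝[≠] (-1), x < 0 :=
      mem_nhdsWithin_of_mem_nhds (Iio_mem_nhds (by norm_num))
    refine (this.mono fun x hx => ?_).frequently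
    have := h (-x) (by linarith)
    rw [complexMGF_ofReal]
    simpa [mgf] using this
  rw [frequently_iff_seq_forall] at h_real ⊢
  obtain ⟨xs, hx_tendsto, hx_eq⟩ := h_real
  refine ⟨fun n => xs n, ?_, fun n => hx_eq n⟩
  rw [tendsto_nhdsWithin_iff] at hx_tendsto ⊢
  refine ⟨(Complex.continuous_ofReal.tendsto _).comp hx_tendsto.1, ?_⟩
  filter_upwards [hx_tendsto.2] with n hn
  simpa [← Complex.ofReal_one, ← Complex.ofReal_neg] using hn

/-- The characteristic function is the boundary value of the Laplace transform. -/
lemma tendsto_complexMGF_charFun (hμ : ∀ᵐ x ∂μ, 0 ≤ x) (t : ℝ) :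
    Tendsto (fun ε : ℝ => complexMGF id μ (-ε + t * Complex.I)) (𝓝[>] 0) (𝓝 (charFun μ t)) := by
  rw [charFun_apply_real]
  refine tendsto_integral_filter_of_dominated_convergence (fun _ => 1)
    (Eventually.of_forall fun ε => by fun_prop) ?_ (integrable_const _) ?_
  · filter_upwards [self_mem_nhdsWithin] with ε hε
    have hε : 0 < ε := hε
    filter_upwards [hμ] with x hx
    rw [Complex.norm_exp, Real.exp_le_one_iff]
    simp
    positivity
  · refine Eventually.of_forall fun x => ?_
    have hc : Continuous fun ε : ℝ => Complex.exp ((-ε + t * Complex.I) * (id x : ℝ)) := by fun_prop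
    have := (hc.tendsto 0).mono_left (nhdsWithin_le_nhds (s := Ioi 0))
    simpa [mul_right_comm] using this

/-- Finite measures on `[0, ∞)` with the same Laplace transform coincide. -/
lemma measure_ext_of_laplace {ν : Measure ℝ} [IsFiniteMeasure ν] (hμ : ∀ᵐ x ∂μ, 0 ≤ x)
    (hν : ∀ᵐ x ∂ν, 0 ≤ x)
    (h : ∀ l : ℝ, 0 < l → ∫ x, Real.exp (-(l * x)) ∂μ = ∫ x, Real.exp (-(l * x)) ∂ν) : μ = ν := by
  have hEq : EqOn (complexMGF id μ) (complexMGF id ν) {z | z.re < 0} := by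
    refine eqOn_complexMGF_halfPlane hμ (analyticOnNhd_complexMGF_halfPlane hν) fun l hl => ?_
    rw [h l hl, ← Complex.ofReal_neg, complexMGF_ofReal]
    simp [mgf]
  refine Measure.ext_of_charFun (funext fun t => ?_)
  refine tendsto_nhds_unique (tendsto_complexMGF_charFun hμ t) ?_
  refine (tendsto_complexMGF_charFun hν t).congr' ?_
  filter_upwards [self_mem_nhdsWithin] with ε hε
  have hε : 0 < ε := hε
  exact (hEq (by simpa using hε)).symm

end HalfPlane

/-! ### Characteristic function of the stable law. -/

section Stable

variable {α : ℝ} {μ : Measure ℝ}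

lemma IsPositiveStableLaw.nonneg (hμ : IsPositiveStableLaw α μ) : ∀ᵐ x ∂μ, 0 ≤ x :=
  hμ.pos.mono fun _ hx => hx.le

lemma neg_mem_slitPlane_of_re_neg {z : ℂ} (hz : z.re < 0) : -z ∈ Complex.slitPlane :=
  Or.inl (by simpa using hz)

lemma analyticOnNhd_exp_neg_cpow :
    AnalyticOnNhd ℂ (fun z : ℂ => Complex.exp (-((-z) ^ (α : ℂ)))) {z | z.re < 0} := by
  refine DifferentiableOn.analyticOnNhd (fun z hz => ?_) (isOpen_lt Complex.continuous_re continuous_const)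
  refine DifferentiableAt.differentiableWithinAt ?_
  exact ((differentiableAt_id.neg.cpow_const (neg_mem_slitPlane_of_re_neg hz)).neg).cexp

lemma IsPositiveStableLaw.complexMGF_eq (hμ : IsPositiveStableLaw α μ) {z : ℂ} (hz : z.re < 0) :
    complexMGF id μ z = Complex.exp (-((-z) ^ (α : ℂ))) := by
  have := hμ.isProbabilityMeasure
  refine eqOn_complexMGF_halfPlane hμ.nonneg analyticOnNhd_exp_neg_cpow (fun l hl => ?_) hz
  rw [hμ.laplace l hl.le, neg_neg, ← Complex.ofReal_cpow hl.le]
  push_cast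
  rfl

/-- For t ≠ 0 the boundary point -it is off the branch cut, so the half-plane formula passes to the
limit. -/
lemma IsPositiveStableLaw.charFun_eq (hμ : IsPositiveStableLaw α μ) {t : ℝ} (ht : t ≠ 0) :
    charFun μ t = Complex.exp (-((-(t * Complex.I)) ^ (α : ℂ))) := by
  have := hμ.isProbabilityMeasure
  refine tendsto_nhds_unique (tendsto_complexMGF_charFun hμ.nonneg t) ?_
  have hc : ContinuousAt (fun ε : ℝ => Complex.exp (-((-(-ε + t * Complex.I)) ^ (α : ℂ)))) 0 := by
    refine (ContinuousAt.neg ?_).cexp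
    refine ContinuousAt.cpow (by fun_prop) continuousAt_const ?_
    right
    simpa using ht
  have h := hc.tendsto.mono_left (nhdsWithin_le_nhds (s := Ioi 0))
  simp only [Complex.ofReal_zero, neg_zero, zero_add] at h
  refine h.congr' ?_
  filter_upwards [self_mem_nhdsWithin] with ε hε
  have hε : 0 < ε := hε
  exact (hμ.complexMGF_eq (by simpa using hε)).symm

lemma re_neg_mul_I_cpow (α : ℝ) {t : ℝ} (ht : t ≠ 0) :
    ((-((t : ℂ) * Complex.I)) ^ (α : ℂ)).re = |t| ^ α * Real.cos (Real.pi / 2 * α) := by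
  rw [Complex.cpow_ofReal_re]
  have hn : ‖-((t : ℂ) * Complex.I)‖ = |t| := by simp
  rw [hn]
  congr 1
  rcases ht.lt_or_gt with h | h
  · rw [show -((t : ℂ) * Complex.I) = ((-t : ℝ) : ℂ) * Complex.I by push_cast; ring,
      Complex.arg_real_mul _ (by linarith), Complex.arg_I]
  · rw [show -((t : ℂ) * Complex.I) = (t : ℂ) * (-Complex.I) by ring,
      Complex.arg_real_mul _ h, Complex.arg_neg_I, neg_mul, Real.cos_neg]

/-- For α in (0,1) the cosine is positive; the resulting decay beats every power of t and makes the
density smooth. -/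
lemma IsPositiveStableLaw.norm_charFun (hμ : IsPositiveStableLaw α μ) {t : ℝ} (ht : t ≠ 0) :
    ‖charFun μ t‖ = Real.exp (-(Real.cos (Real.pi / 2 * α) * |t| ^ α)) := by
  rw [hμ.charFun_eq ht, Complex.norm_exp, Complex.neg_re, re_neg_mul_I_cpow α ht, mul_comm]

lemma cos_pi_div_two_mul_pos (hα : α ∈ Ioo (0 : ℝ) 1) : 0 < Real.cos (Real.pi / 2 * α) := by
  have := Real.pi_pos
  have h1 := hα.1
  have h2 := hα.2
  refine Real.cos_pos_of_mem_Ioo ⟨?_, ?_⟩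
  · have : 0 < Real.pi / 2 * α := by positivity
    linarith
  · nlinarith

end Stable

lemma integrable_abs_pow_mul_exp_neg_rpow (k : ℕ) {α b : ℝ} (hα : 0 < α) (hb : 0 < b) :
    Integrable fun x : ℝ => |x| ^ k * Real.exp (-(b * |x| ^ α)) := by
  have h := integrableOn_rpow_mul_exp_neg_mul_rpow (p := α) (s := k) (b := b)
    (by have : (0 : ℝ) ≤ k := k.cast_nonneg
        linarith) hα hb
  have hpos : IntegrableOn (fun x : ℝ => |x| ^ k * Real.exp (-(b * |x| ^ α))) (Ioi 0) := by
    refine h.congr_fun (fun x hx => ?_) measurableSet_Ioi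
    have hx : 0 < x := hx
    simp [abs_of_pos hx]
  have hneg : IntegrableOn (fun x : ℝ => |x| ^ k * Real.exp (-(b * |x| ^ α))) (Iio 0) := by
    have := IntegrableOn.comp_neg_Iio (c := (0 : ℝ)) (by simpa using hpos)
    simpa using this
  have := ((integrableOn_Iic_iff_integrableOn_Iio).2 hneg).union hpos
  rwa [Iic_union_Ioi, integrableOn_univ] at this

/-! ### Smoothness by Fourier inversion. -/

section Smooth

variable {α : ℝ} {f : ℝ → ℝ}

/-- The measure on `(0, ∞)` with density `f`. -/
noncomputable def densityLaw (f : ℝ → ℝ) : Measure ℝ :=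
  (volume.restrict (Ioi (0 : ℝ))).withDensity (fun x => ENNReal.ofReal (f x))

lemma IsPositiveStableDensity.aemeasurable (hf : IsPositiveStableDensity α f) :
    AEMeasurable f (volume.restrict (Ioi 0)) :=
  hf.continuousOn.aemeasurable measurableSet_Ioi

lemma IsPositiveStableDensity.integrableOn (hf : IsPositiveStableDensity α f) :
    IntegrableOn f (Ioi 0) := by
  refine ⟨hf.aemeasurable.aestronglyMeasurable, ?_⟩
  have := hf.isLaw.isProbabilityMeasure
  have h1 := measure_univ (μ := (volume.restrict (Ioi (0 : ℝ))).withDensity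
    (fun x => ENNReal.ofReal (f x)))
  rw [withDensity_apply _ MeasurableSet.univ, Measure.restrict_univ] at h1
  rw [hasFiniteIntegral_iff_norm]
  have h2 : ∫⁻ x in Ioi (0 : ℝ), ENNReal.ofReal ‖f x‖ = ∫⁻ x in Ioi (0 : ℝ), ENNReal.ofReal (f x) :=
    setLIntegral_congr_fun measurableSet_Ioi fun x hx => by
      rw [Real.norm_of_nonneg (hf.nonneg x hx)]
  rw [h2, h1]
  exact ENNReal.one_lt_top

lemma integral_densityLaw {E : Type*} [NormedAddCommGroup E] [NormedSpace ℝ E]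
    (hm : AEMeasurable f (volume.restrict (Ioi 0))) (h0 : ∀ x, 0 < x → 0 ≤ f x) (g : ℝ → E) :
    ∫ x, g x ∂(densityLaw f) = ∫ x in Ioi (0 : ℝ), f x • g x := by
  rw [densityLaw, integral_withDensity_eq_integral_toReal_smul₀ hm.ennreal_ofReal
    (Eventually.of_forall fun x => ENNReal.ofReal_lt_top)]
  refine setIntegral_congr_fun measurableSet_Ioi fun x hx => ?_
  simp only [ENNReal.toReal_ofReal (h0 x hx)]

/-- The extension by zero of a density on `(0, ∞)`. -/
noncomputable def zeroExtension (f : ℝ → ℝ) : ℝ → ℂ := (Ioi (0 : ℝ)).indicator fun x => (f x : ℂ)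

lemma IsPositiveStableDensity.integrable_zeroExtension (hf : IsPositiveStableDensity α f) :
    Integrable (zeroExtension f) :=
  (integrable_indicator_iff measurableSet_Ioi).2 hf.integrableOn.ofReal

lemma IsPositiveStableDensity.continuousAt_zeroExtension (hf : IsPositiveStableDensity α f) {v : ℝ}
    (hv : v ≠ 0) : ContinuousAt (zeroExtension f) v := by
  rcases hv.lt_or_gt with h | h
  · refine (continuousAt_const (y := (0 : ℂ))).congr ?_
    filter_upwards [Iio_mem_nhds h] with x hx
    rw [zeroExtension, indicator_of_notMem (notMem_Ioi.2 (le_of_lt hx))]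
  · have : ContinuousAt (fun x => (f x : ℂ)) v :=
      (Complex.continuous_ofReal.continuousAt).comp (hf.continuousOn.continuousAt (Ioi_mem_nhds h))
    refine this.congr ?_
    filter_upwards [Ioi_mem_nhds h] with x hx
    rw [zeroExtension, indicator_of_mem hx]

lemma IsPositiveStableDensity.fourier_zeroExtension (hf : IsPositiveStableDensity α f) (v : ℝ) :
    𝓕 (zeroExtension f) v = charFun (densityLaw f) (-2 * Real.pi * v) := by
  rw [charFun_apply_real, integral_densityLaw hf.aemeasurable hf.nonneg, Real.fourier_real_eq_integral_exp_smul,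
    ← integral_indicator measurableSet_Ioi]
  refine integral_congr_ae (Eventually.of_forall fun x => ?_)
  by_cases hx : x ∈ Ioi (0 : ℝ)
  · simp only [zeroExtension, indicator_of_mem hx, smul_eq_mul, Complex.real_smul]
    push_cast
    ring_nf
  · simp only [zeroExtension, indicator_of_notMem hx, smul_zero]

lemma IsPositiveStableDensity.integrable_pow_smul_fourier (hα : α ∈ Ioo (0 : ℝ) 1)
    (hf : IsPositiveStableDensity α f) (k : ℕ) :
    Integrable fun x : ℝ => x ^ k • 𝓕 (zeroExtension f) (-x) := by
  have hlaw : IsPositiveStableLaw α (densityLaw f) := hf.isLaw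
  have := hlaw.isProbabilityMeasure
  have hb : 0 < Real.cos (Real.pi / 2 * α) * (2 * Real.pi) ^ α :=
    mul_pos (cos_pi_div_two_mul_pos hα) (by positivity)
  refine (integrable_abs_pow_mul_exp_neg_rpow k hα.1 hb).mono' ?_ ?_
  · simp_rw [hf.fourier_zeroExtension]
    have := (measurable_charFun (μ := densityLaw f)).comp
      (show Measurable fun x : ℝ => -2 * Real.pi * -x by fun_prop)
    exact ((measurable_id.pow_const k).smul this).aestronglyMeasurable
  · filter_upwards [compl_mem_ae_iff.2 (measure_singleton (0 : ℝ))] with x hx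
    have hx : x ≠ 0 := hx
    rw [norm_smul, norm_pow, Real.norm_eq_abs, hf.fourier_zeroExtension,
      show -2 * Real.pi * -x = 2 * Real.pi * x by ring,
      hlaw.norm_charFun (by positivity), abs_mul, abs_of_pos Real.two_pi_pos,
      Real.mul_rpow Real.two_pi_pos.le (abs_nonneg x), mul_assoc]

/-- The stable density extends to a smooth function on `ℝ`, with bounded derivatives, that
vanishes on the negative half-line. -/
lemma IsPositiveStableDensity.exists_smooth_extension (hα : α ∈ Ioo (0 : ℝ) 1)
    (hf : IsPositiveStableDensity α f) :
    ∃ F : ℝ → ℂ, ContDiff ℝ ∞ F ∧ (∀ k : ℕ, ∃ B, ∀ x, ‖iteratedDeriv k F x‖ ≤ B) ∧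
      (∀ x < 0, F x = 0) ∧ ∀ x, 0 < x → F x = f x := by
  have hint := hf.integrable_pow_smul_fourier hα
  -- Pointwise inversion needs continuity at v, and nothing is known yet about f near 0.
  have hinv : ∀ v : ℝ, v ≠ 0 → 𝓕⁻ (𝓕 (zeroExtension f)) v = zeroExtension f v := fun v hv => by
    refine hf.integrable_zeroExtension.fourierInv_fourier_eq ?_ (hf.continuousAt_zeroExtension hv)
    simpa using (hint 0).comp_neg
  -- This is the inverse transform, written as a forward one of the reflected function so that
  -- integrable moments yield derivatives.
  refine ⟨𝓕 fun x => 𝓕 (zeroExtension f) (-x), ?_, fun k => ?_, fun x hx => ?_, fun x hx => ?_⟩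
  · refine Real.contDiff_fourier (N := ⊤) fun n _ => ?_
    simpa [norm_smul] using (hint n).norm
  · refine ⟨∫ x : ℝ, ‖(-2 * Real.pi * Complex.I * x) ^ k • 𝓕 (zeroExtension f) (-x)‖, fun x => ?_⟩
    rw [Real.iteratedDeriv_fourier (N := ⊤) (fun n _ => hint n) le_top]
    exact VectorFourier.norm_fourierIntegral_le_integral_norm _ _ _ _ _
  · rw [← Real.fourierInv_eq_fourier_comp_neg, hinv x hx.ne, zeroExtension,
      indicator_of_notMem (notMem_Ioi.2 hx.le)]
  · rw [← Real.fourierInv_eq_fourier_comp_neg, hinv x hx.ne', zeroExtension,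
      indicator_of_mem (mem_Ioi.2 hx)]

end Smooth

/-! ### Flatness at the origin and Taylor bounds. -/

section Flat

variable {F : ℝ → ℂ}

lemma iteratedDeriv_eq_zero_of_nonpos (hF : ContDiff ℝ ∞ F) (h0 : ∀ x < 0, F x = 0) (k : ℕ) :
    ∀ x ≤ 0, iteratedDeriv k F x = 0 := by
  have hneg : EqOn (iteratedDeriv k F) (fun _ => 0) (Iio 0) := fun x hx => by
    have : F =ᶠ[𝓝 x] fun _ => 0 := by
      filter_upwards [Iio_mem_nhds hx] with y hy using h0 y hy
    rw [this.iteratedDeriv_eq]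
    simp
  have hc : Continuous (iteratedDeriv k F) := hF.continuous_iteratedDeriv k (by exact_mod_cast le_top)
  have := hneg.closure hc continuous_const
  rw [closure_Iio] at this
  exact this

/-- A smooth function with bounded derivatives that vanishes on the negative half-line is flat
at the origin, together with its derivatives, with bounds valid on the whole half-line. -/
lemma exists_norm_iteratedDeriv_le (hF : ContDiff ℝ ∞ F)
    (hB : ∀ k : ℕ, ∃ B, ∀ x, ‖iteratedDeriv k F x‖ ≤ B) (h0 : ∀ x < 0, F x = 0) (N k : ℕ) :
    ∃ B, ∀ x, 0 ≤ x → ‖iteratedDeriv k F x‖ ≤ B * x ^ N := by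
  induction N generalizing k with
  | zero =>
    obtain ⟨B, hB⟩ := hB k
    exact ⟨B, fun x _ => by simpa using hB x⟩
  | succ N ih =>
    -- Since the k-th derivative vanishes at 0, a bound x^N on the next derivative gains one power
    -- by the mean value inequality on [0, x].
    obtain ⟨B, hB⟩ := ih (k + 1)
    have hB0 : 0 ≤ B := by simpa using (norm_nonneg _).trans (hB 1 zero_le_one)
    refine ⟨B, fun x hx => ?_⟩
    have hd : ∀ y, HasDerivAt (iteratedDeriv k F) (iteratedDeriv (k + 1) F y) y := fun y => by
      rw [iteratedDeriv_succ]
      exact (hF.differentiable_iteratedDeriv k (by exact_mod_cast WithTop.coe_lt_top _) y).hasDerivAt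
    have h := Convex.norm_image_sub_le_of_norm_hasDerivWithin_le (C := B * x ^ N)
      (fun y _ => (hd y).hasDerivWithinAt) (fun y hy => (hB y hy.1).trans
        (mul_le_mul_of_nonneg_left (pow_le_pow_left₀ hy.1 hy.2 N) hB0)) (convex_Icc 0 x)
      (left_mem_Icc.2 hx) (right_mem_Icc.2 hx)
    rw [iteratedDeriv_eq_zero_of_nonpos hF h0 k 0 le_rfl, sub_zero, sub_zero,
      Real.norm_of_nonneg hx] at h
    rw [pow_succ]
    linarith

/-- F'(x) x is the derivative of t ↦ F(xt) at t = 1. The remainder is the flat bound on F'' times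
(x(t-1))², whence the exponent N + 2. -/
lemma exists_taylor_bound (hF : ContDiff ℝ ∞ F)
    (hB : ∀ k : ℕ, ∃ B, ∀ x, ‖iteratedDeriv k F x‖ ≤ B) (h0 : ∀ x < 0, F x = 0) (N : ℕ) :
    ∃ C, ∀ x, 0 < x → ‖deriv F x * x‖ ≤ C * x ^ (N + 2) ∧
      ∀ t, 0 < t → ‖F (x * t) - F x - deriv F x * x * (t - 1)‖
        ≤ C * x ^ (N + 2) * ((t - 1) ^ 2 * (1 + t ^ N)) := by
  obtain ⟨B₁, h1⟩ := exists_norm_iteratedDeriv_le hF hB h0 (N + 1) 1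
  obtain ⟨B₂, h2⟩ := exists_norm_iteratedDeriv_le hF hB h0 N 2
  have hB1 : 0 ≤ B₁ := by simpa using (norm_nonneg _).trans (h1 1 zero_le_one)
  have hB2 : 0 ≤ B₂ := by simpa using (norm_nonneg _).trans (h2 1 zero_le_one)
  have hd1 : ∀ y, HasDerivAt F (deriv F y) y := fun y =>
    (hF.differentiable (by simp) y).hasDerivAt
  have hd2 : ∀ y, HasDerivAt (deriv F) (iteratedDeriv 2 F y) y := fun y => by
    have := hF.differentiable_iteratedDeriv 1 (by exact_mod_cast WithTop.coe_lt_top _) y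
    rw [iteratedDeriv_succ, iteratedDeriv_one]
    rw [iteratedDeriv_one] at this
    exact this.hasDerivAt
  rw [iteratedDeriv_one] at h1
  refine ⟨B₁ + B₂, fun x hx => ⟨?_, fun t ht => ?_⟩⟩
  · rw [norm_mul, Complex.norm_real, Real.norm_of_nonneg hx.le]
    calc _ ≤ B₁ * x ^ (N + 1) * x := mul_le_mul_of_nonneg_right (h1 x hx.le) hx.le
      _ = B₁ * x ^ (N + 2) := by ring
      _ ≤ _ := by gcongr; linarith
  · have hxt : 0 < x * t := mul_pos hx ht
    -- [0, M] contains both x and xt, and M^N ≤ x^N (1 + t^N) explains the last factor of the bound.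
    set M := x * max 1 t with hM
    have hxM : x ≤ M := by
      rw [hM]; nlinarith [le_max_left 1 t]
    have hxtM : x * t ≤ M := by
      rw [hM]; exact mul_le_mul_of_nonneg_left (le_max_right _ _) hx.le
    have hb2 : ∀ y ∈ Icc 0 M, ‖iteratedDeriv 2 F y‖ ≤ B₂ * M ^ N := fun y hy =>
      (h2 y hy.1).trans (mul_le_mul_of_nonneg_left (pow_le_pow_left₀ hy.1 hy.2 N) hB2)
    have hlip : ∀ y ∈ uIcc x (x * t), ‖deriv F y - deriv F x‖ ≤ B₂ * M ^ N * |x * t - x| := by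
      intro y hy
      have hyM : y ∈ Icc 0 M :=
        (uIcc_subset_Icc ⟨hx.le, hxM⟩ ⟨hxt.le, hxtM⟩) hy
      have h := Convex.norm_image_sub_le_of_norm_hasDerivWithin_le
        (fun y _ => (hd2 y).hasDerivWithinAt) hb2 (convex_Icc 0 M) ⟨hx.le, hxM⟩ hyM
      refine h.trans (mul_le_mul_of_nonneg_left ?_ (by positivity))
      exact abs_sub_left_of_mem_uIcc hy
    have h := Convex.norm_image_sub_le_of_norm_hasDerivWithin_le
      (f := fun y : ℝ => F y - deriv F x * y) (f' := fun y => deriv F y - deriv F x)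
      (s := uIcc x (x * t)) (x := x) (y := x * t)
      (fun y _ => by
        have := (hd1 y).sub ((Complex.ofRealCLM.hasDerivAt (x := y)).const_mul (deriv F x))
        exact HasDerivAt.hasDerivWithinAt (by rwa [Complex.ofRealCLM_apply, Complex.ofReal_one, mul_one] at this))
      hlip (convex_uIcc _ _) left_mem_uIcc right_mem_uIcc
    have e : F (x * t) - F x - deriv F x * x * (t - 1)
        = (F (x * t) - deriv F x * (x * t : ℝ)) - (F x - deriv F x * x) := by
      push_cast; ring
    rw [e]
    refine h.trans ?_
    rw [Real.norm_eq_abs]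
    have hmax : max 1 t ^ N ≤ 1 + t ^ N := by
      rcases le_total 1 t with h | h
      · rw [max_eq_right h]; linarith
      · rw [max_eq_left h, one_pow]; have := pow_nonneg ht.le N; linarith
    have e2 : B₂ * M ^ N * |x * t - x| * |x * t - x|
        = B₂ * x ^ (N + 2) * ((t - 1) ^ 2 * max 1 t ^ N) := by
      rw [mul_assoc, abs_mul_abs_self, hM, mul_pow]; ring
    rw [e2]
    gcongr
    linarith

end Flat

/-! ### Laws with a density and their convolutions. -/

section DensityLaw

variable {h : ℝ → ℝ}

lemma densityLaw_eq_withDensity_indicator (h : ℝ → ℝ) : densityLaw h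
    = volume.withDensity ((Ioi (0 : ℝ)).indicator fun x => ENNReal.ofReal (h x)) := by
  rw [densityLaw, withDensity_indicator measurableSet_Ioi]

lemma isFiniteMeasure_densityLaw (hi : IntegrableOn h (Ioi 0)) : IsFiniteMeasure (densityLaw h) :=
  isFiniteMeasure_withDensity_ofReal hi.hasFiniteIntegral

lemma densityLaw_pos (h : ℝ → ℝ) : ∀ᵐ x ∂(densityLaw h), 0 < x :=
  (withDensity_absolutelyContinuous _ _).ae_le (ae_restrict_mem measurableSet_Ioi)

lemma laplace_conv {μ ν : Measure ℝ} [IsFiniteMeasure μ] [IsFiniteMeasure ν] (l : ℝ) :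
    ∫ x, Real.exp (-(l * x)) ∂(μ.conv ν)
      = (∫ x, Real.exp (-(l * x)) ∂μ) * ∫ x, Real.exp (-(l * x)) ∂ν := by
  rw [Measure.conv, integral_map (by fun_prop) (by fun_prop), ← integral_prod_mul]
  refine integral_congr_ae (Eventually.of_forall fun p => ?_)
  simp only
  rw [← Real.exp_add]
  ring_nf

lemma nonneg_conv {μ ν : Measure ℝ} [IsFiniteMeasure μ] [IsFiniteMeasure ν]
    (hμ : ∀ᵐ x ∂μ, 0 ≤ x) (hν : ∀ᵐ x ∂ν, 0 ≤ x) : ∀ᵐ x ∂(μ.conv ν), 0 ≤ x := by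
  rw [Measure.conv, ae_map_iff (by fun_prop) measurableSet_Ici]
  filter_upwards [Measure.quasiMeasurePreserving_fst.ae hμ,
    Measure.quasiMeasurePreserving_snd.ae hν] with p h1 h2 using add_nonneg h1 h2

end DensityLaw

/-! ### Size-biasing and the lower bound on the density. -/

section SizeBias

variable {α : ℝ} {f : ℝ → ℝ}

/-- The density of the exponentially tilted Lévy measure, weighted by the jump size. -/
noncomputable def levyKernel (α x : ℝ) : ℝ :=
  α / Real.Gamma (1 - α) * (x ^ (-α) * Real.exp (-x))

lemma levyKernel_const_pos (hα : α ∈ Ioo (0 : ℝ) 1) : 0 < α / Real.Gamma (1 - α) :=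
  div_pos hα.1 (Real.Gamma_pos_of_pos (by linarith [hα.2]))

lemma levyKernel_nonneg (hα : α ∈ Ioo (0 : ℝ) 1) {x : ℝ} (hx : 0 < x) : 0 ≤ levyKernel α x := by
  have := levyKernel_const_pos hα
  unfold levyKernel
  positivity

lemma integrableOn_levyKernel (hα : α ∈ Ioo (0 : ℝ) 1) : IntegrableOn (levyKernel α) (Ioi 0) := by
  have := integrableOn_rpow_mul_exp_neg_mul_rpow (p := 1) (s := -α) (b := 1)
    (by linarith [hα.2]) one_pos one_pos
  refine IntegrableOn.congr_fun (this.const_mul (α / Real.Gamma (1 - α))) (fun x _ => ?_)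
    measurableSet_Ioi
  simp only [levyKernel, Real.rpow_one, neg_one_mul]

/-- The constant in `levyKernel` is chosen so that this is the derivative of the tilted Laplace
exponent (1 + l)^α. -/
lemma laplace_levyKernel (hα : α ∈ Ioo (0 : ℝ) 1) {l : ℝ} (hl : 0 < l) :
    ∫ x, Real.exp (-(l * x)) ∂(densityLaw (levyKernel α)) = α * (1 + l) ^ (α - 1) := by
  rw [integral_densityLaw (integrableOn_levyKernel hα).aemeasurable
    fun x hx => levyKernel_nonneg hα hx]
  have hG := (Real.Gamma_pos_of_pos (show 0 < 1 - α by linarith [hα.2])).ne'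
  have h := Real.integral_rpow_mul_exp_neg_mul_Ioi (a := 1 - α) (r := 1 + l)
    (by linarith [hα.2]) (by linarith)
  have e : ∀ x : ℝ, levyKernel α x • Real.exp (-(l * x))
      = α / Real.Gamma (1 - α) * (x ^ (1 - α - 1) * Real.exp (-((1 + l) * x))) := fun x => by
    rw [levyKernel, smul_eq_mul, show -((1 + l) * x) = -x + -(l * x) by ring, Real.exp_add,
      show 1 - α - 1 = -α by ring]
    ring
  simp_rw [e]
  rw [integral_const_mul, h, one_div, Real.inv_rpow (by linarith), ← Real.rpow_neg (by linarith),
    neg_sub]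
  field_simp

lemma IsPositiveStableLaw.integral_mul_exp {μ : Measure ℝ} (hμ : IsPositiveStableLaw α μ) {s : ℝ}
    (hs : 0 < s) :
    ∫ x, x * Real.exp (-(s * x)) ∂μ = α * s ^ (α - 1) * Real.exp (-(s ^ α)) := by
  have := hμ.isProbabilityMeasure
  have h1 := hasDerivAt_mgf (X := id) (μ := μ) (t := -s)
    (Iio_subset_interior_integrableExpSet hμ.nonneg (by simpa using hs))
  have h2 : HasDerivAt (fun t : ℝ => Real.exp (-((-t) ^ α)))
      (α * s ^ (α - 1) * Real.exp (-(s ^ α))) (-s) := by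
    have h3 : HasDerivAt (fun t : ℝ => (-t) ^ α) (-1 * α * (-(-s)) ^ (α - 1)) (-s) :=
      (hasDerivAt_neg (-s)).rpow_const (Or.inl (by simpa using hs.ne'))
    refine h3.fun_neg.exp.congr_deriv ?_
    simp only [neg_neg]
    ring
  have h4 : mgf id μ =ᶠ[𝓝 (-s)] fun t : ℝ => Real.exp (-((-t) ^ α)) := by
    filter_upwards [Iio_mem_nhds (show -s < 0 by linarith)] with t ht
    have ht : t < 0 := ht
    rw [← hμ.laplace (-t) (by linarith)]
    simp [mgf]
  have h5 := h1.unique (h2.congr_of_eventuallyEq h4)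
  rw [← h5]
  simp

/-- The tilted density `exp (-x) f(x)`. -/
noncomputable def tiltedDensity (f : ℝ → ℝ) (x : ℝ) : ℝ := f x * Real.exp (-x)

/-- The size-biased tilted density `x exp (-x) f(x)`. -/
noncomputable def sizeBiasedDensity (f : ℝ → ℝ) (x : ℝ) : ℝ := x * (f x * Real.exp (-x))

namespace IsPositiveStableDensity

lemma aemeasurable_tiltedDensity (hf : IsPositiveStableDensity α f) :
    AEMeasurable (tiltedDensity f) (volume.restrict (Ioi 0)) :=
  hf.aemeasurable.mul (by fun_prop)

lemma aemeasurable_sizeBiasedDensity (hf : IsPositiveStableDensity α f) :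
    AEMeasurable (sizeBiasedDensity f) (volume.restrict (Ioi 0)) :=
  aemeasurable_id.mul hf.aemeasurable_tiltedDensity

lemma tiltedDensity_nonneg (hf : IsPositiveStableDensity α f) {x : ℝ} (hx : 0 < x) :
    0 ≤ tiltedDensity f x :=
  mul_nonneg (hf.nonneg x hx) (Real.exp_pos _).le

lemma sizeBiasedDensity_nonneg (hf : IsPositiveStableDensity α f) {x : ℝ} (hx : 0 < x) :
    0 ≤ sizeBiasedDensity f x :=
  mul_nonneg hx.le (hf.tiltedDensity_nonneg hx)

lemma integrableOn_tiltedDensity (hf : IsPositiveStableDensity α f) :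
    IntegrableOn (tiltedDensity f) (Ioi 0) := by
  refine hf.integrableOn.mono' hf.aemeasurable_tiltedDensity.aestronglyMeasurable ?_
  refine (ae_restrict_iff' measurableSet_Ioi).2 (Eventually.of_forall fun x hx => ?_)
  have hx : 0 < x := hx
  rw [Real.norm_of_nonneg (hf.tiltedDensity_nonneg hx)]
  exact mul_le_of_le_one_right (hf.nonneg x hx) (Real.exp_le_one_iff.2 (by linarith))

lemma integrableOn_sizeBiasedDensity (hf : IsPositiveStableDensity α f) :
    IntegrableOn (sizeBiasedDensity f) (Ioi 0) := by
  refine hf.integrableOn.mono' hf.aemeasurable_sizeBiasedDensity.aestronglyMeasurable ?_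
  refine (ae_restrict_iff' measurableSet_Ioi).2 (Eventually.of_forall fun x hx => ?_)
  have hx : 0 < x := hx
  rw [Real.norm_of_nonneg (hf.sizeBiasedDensity_nonneg hx), sizeBiasedDensity, mul_left_comm]
  refine mul_le_of_le_one_right (hf.nonneg x hx) ?_
  rw [Real.exp_neg, ← div_eq_mul_inv, div_le_one (Real.exp_pos x)]
  linarith [Real.add_one_le_exp x]

/-- The size-biasing identity: the tilted stable law, weighted by `x`, is the convolution of the
tilted stable law with the weighted Lévy measure. -/
lemma sizeBiased_eq_conv (hα : α ∈ Ioo (0 : ℝ) 1) (hf : IsPositiveStableDensity α f) :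
    densityLaw (sizeBiasedDensity f)
      = (densityLaw (tiltedDensity f)).conv (densityLaw (levyKernel α)) := by
  have hlaw : IsPositiveStableLaw α (densityLaw f) := hf.isLaw
  have := isFiniteMeasure_densityLaw hf.integrableOn_sizeBiasedDensity
  have := isFiniteMeasure_densityLaw hf.integrableOn_tiltedDensity
  have := isFiniteMeasure_densityLaw (integrableOn_levyKernel hα)
  have hnn : ∀ h : ℝ → ℝ, ∀ᵐ x ∂(densityLaw h), 0 ≤ x := fun h =>
    (densityLaw_pos h).mono fun _ hx => hx.le
  -- On transforms the identity is the chain rule for -d/dl exp(-(1+l)^α). The tilt shifts l by 1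
  -- and makes the size-biased law and the kernel finite measures.
  refine measure_ext_of_laplace (hnn _) (nonneg_conv (hnn _) (hnn _)) fun l hl => ?_
  have hexp : ∀ x : ℝ, Real.exp (-x) * Real.exp (-(l * x)) = Real.exp (-((1 + l) * x)) := fun x => by
    rw [← Real.exp_add]; ring_nf
  have h1 : ∫ x, Real.exp (-(l * x)) ∂(densityLaw (tiltedDensity f))
      = Real.exp (-((1 + l) ^ α)) := by
    rw [← hlaw.laplace (1 + l) (by linarith), integral_densityLaw hf.aemeasurable hf.nonneg,
      integral_densityLaw hf.aemeasurable_tiltedDensity fun x hx => hf.tiltedDensity_nonneg hx]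
    simp only [tiltedDensity, smul_eq_mul, mul_assoc, hexp]
  have h2 : ∫ x, Real.exp (-(l * x)) ∂(densityLaw (sizeBiasedDensity f))
      = α * (1 + l) ^ (α - 1) * Real.exp (-((1 + l) ^ α)) := by
    rw [← hlaw.integral_mul_exp (show 0 < 1 + l by linarith),
      integral_densityLaw hf.aemeasurable hf.nonneg,
      integral_densityLaw hf.aemeasurable_sizeBiasedDensity fun x hx => hf.sizeBiasedDensity_nonneg hx]
    simp only [sizeBiasedDensity, smul_eq_mul, mul_assoc, hexp]
    simp only [mul_left_comm]
  rw [laplace_conv, h1, h2, laplace_levyKernel hα hl]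
  ring

lemma sizeBiasedDensity_ae_eq (hα : α ∈ Ioo (0 : ℝ) 1) (hf : IsPositiveStableDensity α f) :
    ((Ioi (0 : ℝ)).indicator fun x => ENNReal.ofReal (sizeBiasedDensity f x)) =ᵐ[volume]
      lconvolution ((Ioi (0 : ℝ)).indicator fun x => ENNReal.ofReal (tiltedDensity f x))
        ((Ioi (0 : ℝ)).indicator fun x => ENNReal.ofReal (levyKernel α x)) volume := by
  have hm : ∀ {h : ℝ → ℝ}, AEMeasurable h (volume.restrict (Ioi 0)) →
      AEMeasurable ((Ioi (0 : ℝ)).indicator fun x => ENNReal.ofReal (h x)) volume := fun hh =>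
    (aemeasurable_indicator_iff measurableSet_Ioi).2 hh.ennreal_ofReal
  have h1 := hm hf.aemeasurable_sizeBiasedDensity
  have h2 := hm hf.aemeasurable_tiltedDensity
  have h3 := hm (integrableOn_levyKernel hα).aemeasurable
  have hfin := isFiniteMeasure_densityLaw hf.integrableOn_sizeBiasedDensity
  have hconv := hf.sizeBiased_eq_conv hα
  rw [densityLaw_eq_withDensity_indicator, densityLaw_eq_withDensity_indicator,
    densityLaw_eq_withDensity_indicator, conv_withDensity_eq_mlconvolution₀ h2 h3] at hconv
  refine (withDensity_eq_iff h1 (aemeasurable_lconvolution h2 h3) ?_).1 hconv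
  have := measure_ne_top (densityLaw (sizeBiasedDensity f)) univ
  rwa [densityLaw_eq_withDensity_indicator, withDensity_apply _ MeasurableSet.univ,
    Measure.restrict_univ] at this

/-- Were the law carried by [a, ∞), its transform would be at most e^(-la), forcing la ≤ l^α for all
l ≥ 0, which fails for large l since α < 1. -/
lemma measure_Iio_pos (hα : α ∈ Ioo (0 : ℝ) 1) (hf : IsPositiveStableDensity α f) {a : ℝ}
    (ha : 0 < a) : 0 < densityLaw f (Iio a) := by
  have hlaw : IsPositiveStableLaw α (densityLaw f) := hf.isLaw
  have := hlaw.isProbabilityMeasure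
  rw [pos_iff_ne_zero]
  intro h0
  have hae : ∀ᵐ x ∂(densityLaw f), a ≤ x := by
    filter_upwards [compl_mem_ae_iff.2 h0] with x hx using not_lt.1 hx
  have hle : ∀ l : ℝ, 0 ≤ l → l * a ≤ l ^ α := by
    intro l hl
    have h1 := hlaw.laplace l hl
    have h2 : ∫ x, Real.exp (-(l * x)) ∂(densityLaw f) ≤ ∫ _, Real.exp (-(l * a)) ∂(densityLaw f) := by
      refine integral_mono_of_nonneg (Eventually.of_forall fun x => (Real.exp_pos _).le)
        (integrable_const _) ?_
      filter_upwards [hae] with x hx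
      exact Real.exp_le_exp.2 (neg_le_neg (mul_le_mul_of_nonneg_left hx hl))
    rw [h1, integral_const, probReal_univ, one_smul, Real.exp_le_exp] at h2
    linarith
  have h1α : 0 < 1 - α := by linarith [hα.2]
  -- Chosen so that la = 2 l^α.
  set l : ℝ := (2 / a) ^ (1 / (1 - α)) with hl
  have hl0 : 0 < l := by positivity
  have hl1 : l ^ (1 - α) = 2 / a := by
    rw [hl, ← Real.rpow_mul (by positivity), one_div_mul_cancel h1α.ne', Real.rpow_one]
  have hl2 : l ^ α * l ^ (1 - α) = l := by
    rw [← Real.rpow_add hl0, add_sub_cancel, Real.rpow_one]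
  have h3 := hle l hl0.le
  rw [hl1] at hl2
  have h4 : l ^ α * 2 = l * a := by
    field_simp at hl2
    linarith
  have : 0 < l ^ α := by positivity
  linarith

/-- The stable density is bounded below by a multiple of `x ^ (-1 - α)` away from the origin. -/
lemma exists_lower_bound (hα : α ∈ Ioo (0 : ℝ) 1) (hf : IsPositiveStableDensity α f) {a : ℝ}
    (ha : 0 < a) : ∃ c : ℝ, 0 < c ∧ ∀ x, a < x → c * x ^ (-α) ≤ x * f x := by
  have hlaw : IsPositiveStableLaw α (densityLaw f) := hf.isLaw
  have := hlaw.isProbabilityMeasure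
  have hp := hf.measure_Iio_pos hα ha
  set p : ℝ := (densityLaw f).real (Iio a) with hp_def
  have hp0 : 0 < p := ENNReal.toReal_pos hp.ne' (measure_ne_top _ _)
  have hK := levyKernel_const_pos hα
  set K := α / Real.Gamma (1 - α) with hK_def
  refine ⟨K * p, mul_pos hK hp0, ?_⟩
  have hmass : densityLaw f (Iio a) = ∫⁻ u in Ioo 0 a, ENNReal.ofReal (f u) := by
    rw [densityLaw, withDensity_apply _ measurableSet_Iio, Measure.restrict_restrict measurableSet_Iio,
      Iio_inter_Ioi]
  -- Only u in (0, a) is kept in the convolution: there (y-u)^(-α) ≥ y^(-α), the exponentials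
  -- combine to e^(-y), and f integrates to p.
  have hae : ∀ᵐ y ∂(volume.restrict (Ioi a)), K * p * y ^ (-α) ≤ y * f y := by
    rw [ae_restrict_iff' measurableSet_Ioi]
    filter_upwards [hf.sizeBiasedDensity_ae_eq hα] with y hy hay
    have hay : a < y := hay
    have hy0 : 0 < y := ha.trans hay
    rw [indicator_of_mem (mem_Ioi.2 hy0), lconvolution_def] at hy
    have hkey : ENNReal.ofReal (K * p * y ^ (-α) * Real.exp (-y))
        ≤ ENNReal.ofReal (sizeBiasedDensity f y) := by
      rw [hy, show K * p * y ^ (-α) * Real.exp (-y) = p * (K * (y ^ (-α) * Real.exp (-y))) by ring,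
        ENNReal.ofReal_mul hp0.le, hp_def, ofReal_measureReal, hmass,
        ← lintegral_mul_const' _ _ ENNReal.ofReal_ne_top]
      refine (setLIntegral_mono' measurableSet_Ioo fun u hu => ?_).trans
        (setLIntegral_le_lintegral (Ioo 0 a) _)
      have hyu : 0 < -u + y := by linarith [hu.2]
      rw [indicator_of_mem (mem_Ioi.2 hu.1), indicator_of_mem (mem_Ioi.2 hyu),
        ← ENNReal.ofReal_mul (hf.nonneg u hu.1), ← ENNReal.ofReal_mul (hf.tiltedDensity_nonneg hu.1)]
      refine ENNReal.ofReal_le_ofReal ?_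
      rw [tiltedDensity, levyKernel, mul_assoc (f u)]
      refine mul_le_mul_of_nonneg_left ?_ (hf.nonneg u hu.1)
      have hexp : Real.exp (-u) * Real.exp (-(-u + y)) = Real.exp (-y) := by
        rw [← Real.exp_add]; ring_nf
      have hrpow : y ^ (-α) ≤ (-u + y) ^ (-α) :=
        Real.rpow_le_rpow_of_nonpos hyu (by linarith [hu.1]) (by linarith [hα.1])
      calc K * (y ^ (-α) * Real.exp (-y)) ≤ K * ((-u + y) ^ (-α) * Real.exp (-y)) := by gcongr
        _ = _ := by rw [← hexp]; ring
    rw [ENNReal.ofReal_le_ofReal_iff (hf.sizeBiasedDensity_nonneg hy0), sizeBiasedDensity,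
      ← mul_assoc] at hkey
    exact le_of_mul_le_mul_right hkey (Real.exp_pos _)
  have hpos : ∀ y ∈ Ioi a, (0 : ℝ) < y := fun y hy => ha.trans hy
  have hc1 : ContinuousOn (fun y : ℝ => K * p * y ^ (-α)) (Ioi a) :=
    continuousOn_const.mul (continuousOn_id.rpow_const fun y hy => Or.inl (hpos y hy).ne')
  have hc2 : ContinuousOn (fun y : ℝ => y * f y) (Ioi a) :=
    continuousOn_id.mul (hf.continuousOn.mono fun y hy => hpos y hy)
  -- Equality of densities holds only almost everywhere. Stating the inequality as an equality with
  -- a maximum lets continuity extend it to every point.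
  have heq : (fun y : ℝ => max (K * p * y ^ (-α)) (y * f y)) =ᵐ[volume.restrict (Ioi a)]
      fun y => y * f y := hae.mono fun y hy => max_eq_right hy
  intro x hx
  exact max_eq_right_iff.1 (Measure.eqOn_open_of_ae_eq heq isOpen_Ioi (hc1.sup hc2) hc2 hx)

/-- The positive stable density meets the requirements of Laplace's method. -/
theorem isLaplaceAdmissible (hα : α ∈ Ioo (0 : ℝ) 1) (hf : IsPositiveStableDensity α f) :
    IsLaplaceAdmissible f := by
  obtain ⟨F, hF, hB, hF0, hFf⟩ := hf.exists_smooth_extension hα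
  refine ⟨hf.continuousOn, fun x hx => ?_, fun N => ?_, ?_, fun N => ?_⟩
  · obtain ⟨c, hc, h⟩ := hf.exists_lower_bound hα (half_pos hx)
    have h1 := h x (half_lt_self hx)
    have : 0 < c * x ^ (-α) := by positivity
    exact pos_of_mul_pos_right (this.trans_le h1) hx.le
  · obtain ⟨B, h⟩ := exists_norm_iteratedDeriv_le hF hB hF0 N 0
    refine ⟨B, fun x hx => (le_abs_self _).trans ?_⟩
    have := h x hx.le
    rwa [iteratedDeriv_zero, hFf x hx, Complex.norm_real] at this
  · obtain ⟨c, hc, h⟩ := hf.exists_lower_bound hα one_half_pos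
    refine ⟨c, 1, hc, fun x hx => ?_⟩
    have hx0 : 0 < x := by linarith
    have h1 : c * x ^ (-α) * x ≤ x * f x * x :=
      mul_le_mul_of_nonneg_right (h x (by linarith)) hx0.le
    -- Here α < 1 turns the tail x^(-1-α) into the cruder lower bound x^(-2).
    have h2 : 1 ≤ x ^ (-α) * x := by
      rw [← Real.rpow_add_one hx0.ne']
      exact Real.one_le_rpow hx (by linarith [hα.2])
    nlinarith
  · obtain ⟨C, hC⟩ := exists_taylor_bound hF hB hF0 N
    refine ⟨C, fun x hx => ⟨(deriv F x * x).re, ?_, fun t ht => ?_⟩⟩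
    · exact (Complex.abs_re_le_norm _).trans (hC x hx).1
    · have h := (Complex.abs_re_le_norm _).trans ((hC x hx).2 t ht)
      rw [hFf x hx, hFf _ (mul_pos hx ht)] at h
      have e : (((f (x * t) : ℂ)) - f x - deriv F x * x * (t - 1)).re
          = f (x * t) - f x - (deriv F x * x).re * (t - 1) := by
        rw [← Complex.ofReal_one, ← Complex.ofReal_sub t, Complex.sub_re, Complex.sub_re,
          Complex.re_mul_ofReal, Complex.ofReal_re, Complex.ofReal_re]
      rwa [e] at h

end IsPositiveStableDensity

end SizeBias

theorem lemma2p4 (α : ℝ) (hα : α ∈ Set.Ioo (0 : ℝ) 1)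
    (f : ℝ → ℝ) (hf : IsPositiveStableDensity α f) :
    ∃ Δ : ℝ → ℝ,
      ContinuousOn Δ (Ioi 0) ∧
      (∀ z : ℝ, 0 < z → 0 < Δ z) ∧
      (Δ =O[𝓝[>] (0 : ℝ)] fun z : ℝ => (z ^ 4)⁻¹) ∧
      (∀ N : ℕ, (fun z : ℝ => Δ z * f (1 / z)) =O[atTop] fun z : ℝ => (z ^ N)⁻¹) ∧
      ∀ n : ℕ, 1 ≤ n →
        ∃ δ : ℝ → ℝ,
          ContinuousOn δ (Ioi 0) ∧
          ∀ z : ℝ, 0 < z →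
            IntegrableOn (fun y : ℝ => Real.exp (-((n : ℝ) * laplacePhase z y)) * f y) (Ioi 0) ∧
            laplaceIntegral f n z =
              (1 / z) ^ (n + 1) * f (1 / z) * Real.exp (-(n : ℝ)) *
                Real.sqrt (2 * Real.pi / (n : ℝ)) * (1 + δ z) ∧
            |δ z| ≤ Δ z / (n : ℝ) :=
  (hf.isLaplaceAdmissible hα).laplace_expansion
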